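/- Let $F_2$ be the free group on two generators $x, y$, whose elements are identified with the reduced words in $x^{\pm1}, y^{\pm1}$; the length of an element is the length of its reduced word. An element is a palindrome if its reduced word reads the same forwards and backwards, and it is primitive if it belongs to some free basis of $F_2$. Let $p \in F_2$ be primitive, and let $X$ and $Y$ be the exponent sums of $x$ and $y$ in $p$. Then: 1. $X+Y$ is odd if and only if the conjugacy class of $p$ contains exactly one palindrome. 2. If $X+Y$ is even, then the conjugacy class of $p$ contains no palindrome, but it contains (a) exactly one element whose reduced word is a concatenation $x^{\varepsilon} w$, where $\varepsilon \in \{1,-1\}$ has the same sign as $X$ and $w \in F_2$ is a palindrome of length $|X|+|Y|-1$; and (b) exactly one element whose reduced word is a concatenation $y^{\delta} v$, where $\delta \in \{1,-1\}$ has the same sign as $Y$ and $v \in F_2$ is a palindrome of length $|X|+|Y|-1$. -/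

import Mathlib

namespace FreeGroupWords

/-- An element of a free group is a palindrome if its reduced word reads the same forwards and
backwards. -/
def IsPalindrome {α : Type} [DecidableEq α] (g : FreeGroup α) : Prop :=
  g.toWord.Palindrome

/-- `g` is the concatenation (without cancellation) of the words `u` and `v`: the reduced word of
`g` is the reduced word of `u` followed by the reduced word of `v`. -/
def IsConcat {α : Type} [DecidableEq α] (g u v : FreeGroup α) : Prop :=
  g.toWord = u.toWord ++ v.toWord

/-- An element of a group is primitive if it belongs to some free basis of the group. -/
def IsPrimitive {G : Type} [Group G] (p : G) : Prop :=
  ∃ (ι : Type) (b : FreeGroupBasis ι G), p ∈ Set.range b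

/-- The exponent sum of the generator `i` in `g`: the value at `g` of the homomorphism to `ℤ` that
sends the generator `i` to `1` and every other generator to `0`. -/
def expSum {α : Type} [DecidableEq α] (i : α) (g : FreeGroup α) : ℤ :=
  Multiplicative.toAdd
    (FreeGroup.lift (fun j : α => Multiplicative.ofAdd (if j = i then (1 : ℤ) else 0)) g)

/-- The first generator of the free group of rank two. -/
def x : FreeGroup (Fin 2) := FreeGroup.of 0

/-- The second generator of the free group of rank two. -/
def y : FreeGroup (Fin 2) := FreeGroup.of 1

end FreeGroupWords

namespace FreeGroupWords

open FreeGroup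

/-! ### Cancellation in free groups, measured by common prefixes. -/

section GromovProduct

variable {α : Type} [DecidableEq α]

/-! Every primitive `p` lies in a generating pair. Nielsen reduction, in the form
`isStandard_of_closure_eq_top`, shows that after simultaneous conjugation and inversion of entries
such a pair arises from signed generators by products of its entries without further inverses. Hence
`p` is conjugate to some `c` in which each generator occurs with one sign only. Moreover, the
anti-automorphism fixing the generators conjugates both entries of such a pair by one common
element, so the reversed word of `c` is a rotation of the word of `c`.

The elements of the conjugacy class that matter are exactly the rotations of this word: a conjugate
that is not a rotation has the form `t L t⁻¹` with `t` nonempty, so it is too long, and it is no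
palindrome because its last letter is inverse to its first. The letter counts are `|X|` and `|Y|`.
They are coprime, so the cyclic word of length `n = |X| + |Y|` is aperiodic and its rotations
correspond to residues mod `n`. Reversal acts on these as a reflection `i ↦ m - i`, and palindromes
are its fixed points, the solutions of `2i = m`. For odd `n` there is exactly one. For even `n` both
counts are odd, which rules out palindromes, so `m` is odd; the reflection then has two antipodal
axes through letters, one letter being a power of `x` and the other of `y`. These yield (a) and (b).
-/

theorem exists_maximal_common_prefix {β : Type*} [DecidableEq β] (L₁ L₂ : List β) :
    ∃ p s t, L₁ = p ++ s ∧ L₂ = p ++ t ∧ ∀ a ∈ s.head?, ∀ b ∈ t.head?, a ≠ b := by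
  induction L₁ generalizing L₂ with
  | nil => exact ⟨[], [], L₂, by simp⟩
  | cons c L₁ ih =>
    cases L₂ with
    | nil => exact ⟨[], c :: L₁, [], by simp⟩
    | cons d L₂ =>
      by_cases h : c = d
      · obtain ⟨p, s, t, rfl, rfl, h'⟩ := ih L₂
        exact ⟨c :: p, s, t, by simp, by simp [h], h'⟩
      · exact ⟨[], c :: L₁, d :: L₂, by simp [h]⟩

theorem isReduced_append {β : Type} {L₁ L₂ : List (β × Bool)} :
    IsReduced (L₁ ++ L₂) ↔ IsReduced L₁ ∧ IsReduced L₂ ∧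
      ∀ a ∈ L₁.getLast?, ∀ b ∈ L₂.head?, a.1 = b.1 → a.2 = b.2 := by
  rw [FreeGroup.IsReduced, FreeGroup.IsReduced, FreeGroup.IsReduced, List.isChain_append]

theorem isReduced_invRev {L : List (α × Bool)} (h : IsReduced L) : IsReduced (invRev L) := by
  rw [isReduced_iff_reduce_eq] at *
  rw [reduce_invRev, h]

theorem toWord_mk_of_isReduced {L : List (α × Bool)} (h : IsReduced L) : (mk L).toWord = L := by
  rw [toWord_mk, h.reduce_eq]

theorem toWord_inv_mul_of_common_prefix {g h : FreeGroup α} {p s t : List (α × Bool)}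
    (hg : g.toWord = p ++ s) (hh : h.toWord = p ++ t)
    (hst : ∀ a ∈ s.head?, ∀ b ∈ t.head?, a ≠ b) : (g⁻¹ * h).toWord = invRev s ++ t := by
  have hs : IsReduced s := (isReduced_append.1 (hg ▸ isReduced_toWord (x := g))).2.1
  have ht : IsReduced t := (isReduced_append.1 (hh ▸ isReduced_toWord (x := h))).2.1
  have hred : IsReduced (invRev s ++ t) := by
    rw [isReduced_append]
    refine ⟨isReduced_invRev hs, ht, ?_⟩
    intro a ha b hb hab
    cases s with
    | nil => simp at ha
    | cons c s =>
      cases t with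
      | nil => simp at hb
      | cons d t =>
        rw [invRev_cons] at ha
        simp [invRev] at ha hb
        subst ha hb
        have := hst c (by simp) d (by simp)
        obtain ⟨c1, c2⟩ := c
        obtain ⟨d1, d2⟩ := d
        simp at hab this ⊢
        have := this hab
        revert this
        cases c2 <;> cases d2 <;> simp
  rw [← toWord_mk_of_isReduced hred]
  congr 1
  rw [← mk_toWord (x := g), ← mk_toWord (x := h), hg, hh, ← mul_mk, ← mul_mk, ← mul_mk, ← inv_mk]
  group

/-- Twice the Gromov product of two elements of a free group, based at the identity. -/
def gromovProduct (g h : FreeGroup α) : ℤ := g.norm + h.norm - (g⁻¹ * h).norm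

theorem gromovProduct_eq_of_common_prefix {g h : FreeGroup α} {p s t : List (α × Bool)}
    (hg : g.toWord = p ++ s) (hh : h.toWord = p ++ t)
    (hst : ∀ a ∈ s.head?, ∀ b ∈ t.head?, a ≠ b) : gromovProduct g h = 2 * p.length := by
  simp only [gromovProduct, FreeGroup.norm, toWord_inv_mul_of_common_prefix hg hh hst, hg, hh,
    List.length_append, invRev_length]
  push_cast
  ring

theorem exists_gromovProduct_eq (g h : FreeGroup α) :
    ∃ p, p <+: g.toWord ∧ p <+: h.toWord ∧ gromovProduct g h = 2 * p.length := by
  obtain ⟨p, s, t, hg, hh, hst⟩ := exists_maximal_common_prefix g.toWord h.toWord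
  exact ⟨p, ⟨s, hg.symm⟩, ⟨t, hh.symm⟩, gromovProduct_eq_of_common_prefix hg hh hst⟩

theorem length_le_gromovProduct {g h : FreeGroup α} {q : List (α × Bool)}
    (hg : q <+: g.toWord) (hh : q <+: h.toWord) : 2 * (q.length : ℤ) ≤ gromovProduct g h := by
  obtain ⟨s, hs⟩ := hg
  obtain ⟨t, ht⟩ := hh
  obtain ⟨p, s', t', rfl, rfl, hst⟩ := exists_maximal_common_prefix s t
  rw [gromovProduct_eq_of_common_prefix (p := q ++ p) (by rw [← hs]; simp) (by rw [← ht]; simp) hst]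
  simp

theorem gromovProduct_comm (g h : FreeGroup α) : gromovProduct g h = gromovProduct h g := by
  have : (h⁻¹ * g).norm = (g⁻¹ * h).norm := by
    rw [← norm_inv_eq]
    simp
  simp only [gromovProduct, this]
  ring

theorem gromovProduct_nonneg (g h : FreeGroup α) : 0 ≤ gromovProduct g h := by
  obtain ⟨p, -, -, h⟩ := exists_gromovProduct_eq g h
  omega

/-- Two prefixes of `h` are comparable, so the shorter is shared by `g` and `k`: the Cayley tree is
0-hyperbolic. -/
theorem min_gromovProduct_le (g h k : FreeGroup α) :
    min (gromovProduct g h) (gromovProduct h k) ≤ gromovProduct g k := by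
  obtain ⟨p, hp₁, hp₂, hp⟩ := exists_gromovProduct_eq g h
  obtain ⟨q, hq₁, hq₂, hq⟩ := exists_gromovProduct_eq h k
  rcases List.prefix_or_prefix_of_prefix hp₂ hq₁ with h' | h'
  · exact (min_le_left _ _).trans (hp ▸ length_le_gromovProduct hp₁ (h'.trans hq₂))
  · exact (min_le_right _ _).trans (hq ▸ length_le_gromovProduct (h'.trans hp₁) hq₂)

/-- If `g = t c t⁻¹` with `c` cyclically reduced, then `t c c t⁻¹` is reduced, and `c` is nonempty.
-/
theorem norm_lt_norm_mul_self {g : FreeGroup α} (hg : g ≠ 1) : g.norm < (g * g).norm := by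
  have h1 := reduceCyclically.conj_conjugator_reduceCyclically g.toWord
  have h2 : (g ^ 2).toWord = _ := (toWord_pow g 2).trans
    (reduceCyclically.reduce_flatten_replicate (isReduced_toWord (x := g)) 2)
  have h3 : reduceCyclically g.toWord ≠ [] := by
    intro h
    rw [h] at h1
    apply hg
    rw [← mk_toWord (x := g), ← h1, List.append_nil, ← mul_mk, ← inv_mk, mul_inv_cancel]
  have h3 := List.length_pos_iff.2 h3
  have h1 := congrArg List.length h1
  rw [← sq, FreeGroup.norm, FreeGroup.norm, h2]
  simp at h1 ⊢
  omega

end GromovProduct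

theorem lift_mk_cons {ι G : Type} [Group G] (f : ι → G) (s : ι × Bool) (L : List (ι × Bool)) :
    lift f (FreeGroup.mk (s :: L)) = cond s.2 (f s.1) (f s.1)⁻¹ * lift f (FreeGroup.mk L) := by
  simp [lift_mk]

/-! ### Nielsen reduced families. -/

section NielsenReduced

variable {ι α : Type} [DecidableEq α]

/-- The value of a letter under the homomorphism from a free group given by a family. -/
def letterValue {ι α : Type} (f : ι → FreeGroup α) (s : ι × Bool) : FreeGroup α :=
  cond s.2 (f s.1) (f s.1)⁻¹

/-- A family in a free group is Nielsen reduced if, in a product of letters without inverse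
neighbours, at most half of a letter cancels against each neighbour and no letter cancels
completely. -/
structure NielsenReduced (f : ι → FreeGroup α) : Prop where
  le_left : ∀ s t : ι × Bool, (s.1 = t.1 → s.2 = t.2) →
    gromovProduct (letterValue f s)⁻¹ (letterValue f t) ≤ (letterValue f s).norm
  le_right : ∀ s t : ι × Bool, (s.1 = t.1 → s.2 = t.2) →
    gromovProduct (letterValue f s)⁻¹ (letterValue f t) ≤ (letterValue f t).norm
  add_lt : ∀ r s t : ι × Bool, (r.1 = s.1 → r.2 = s.2) → (s.1 = t.1 → s.2 = t.2) →
    gromovProduct (letterValue f r)⁻¹ (letterValue f s) +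
      gromovProduct (letterValue f s)⁻¹ (letterValue f t) < 2 * (letterValue f s).norm

theorem gromovProduct_inv_left (g h : FreeGroup α) :
    gromovProduct g⁻¹ h = g.norm + h.norm - (g * h).norm := by
  simp [gromovProduct]

theorem NielsenReduced.norm_pos {f : ι → FreeGroup α} (hf : NielsenReduced f) (s : ι × Bool) :
    0 < (letterValue f s).norm := by
  have := hf.add_lt s s s (fun _ => rfl) (fun _ => rfl)
  have := gromovProduct_nonneg (letterValue f s)⁻¹ (letterValue f s)
  omega

/-- A preceding letter sees only the first letter of a reduced product: later letters never cancel
far enough into it to matter. -/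
theorem NielsenReduced.gromovProduct_lift {f : ι → FreeGroup α} (hf : NielsenReduced f)
    (s : ι × Bool) (L : List (ι × Bool)) (hL : FreeGroup.IsReduced (s :: L)) :
    ((letterValue f s).norm ≤ (lift f (FreeGroup.mk (s :: L))).norm) ∧
      ∀ r : ι × Bool, (r.1 = s.1 → r.2 = s.2) →
        gromovProduct (letterValue f r)⁻¹ (lift f (FreeGroup.mk (s :: L))) =
          gromovProduct (letterValue f r)⁻¹ (letterValue f s) := by
  induction L generalizing s with
  | nil =>
    have : lift f (FreeGroup.mk [s]) = letterValue f s := by simp [lift_mk, letterValue]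
    simp [this]
  | cons t L ih =>
    obtain ⟨hst, hL⟩ : (s.1 = t.1 → s.2 = t.2) ∧ FreeGroup.IsReduced (t :: L) := by
      simpa [FreeGroup.IsReduced] using hL
    obtain ⟨h1, h2⟩ := ih t hL
    rw [lift_mk_cons f s, ← letterValue]
    set g := lift f (FreeGroup.mk (t :: L))
    have h3 := h2 s hst
    have h4 := gromovProduct_inv_left (letterValue f s) g
    have h5 := hf.le_right s t hst
    refine ⟨by omega, fun r hr => ?_⟩
    have h6 : gromovProduct (letterValue f s) (letterValue f s * g) =
        (letterValue f s).norm + (letterValue f s * g).norm - g.norm := by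
      simp [gromovProduct]
    have h7 := hf.add_lt r s t hr hst
    -- By `add_lt`, `s` and `s * g` share more than `r⁻¹` shares with `s`; the ultrametric
    -- inequality, used both ways, then gives equality.
    have h8 := min_gromovProduct_le (letterValue f r)⁻¹ (letterValue f s) (letterValue f s * g)
    have h9 := min_gromovProduct_le (letterValue f r)⁻¹ (letterValue f s * g) (letterValue f s)
    rw [gromovProduct_comm (letterValue f s * g)] at h9
    omega

theorem NielsenReduced.exists_letterValue_eq [DecidableEq ι] {f : ι → FreeGroup α}
    (hf : NielsenReduced f) (w : FreeGroup ι) (hw : (lift f w).norm = 1) :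
    ∃ s, lift f w = letterValue f s := by
  have hred : FreeGroup.IsReduced w.toWord := isReduced_toWord
  rw [← mk_toWord (x := w)] at hw ⊢
  generalize w.toWord = L at hw hred ⊢
  match L, hw, hred with
  | [], hw, _ =>
    rw [← one_eq_mk, _root_.map_one, FreeGroup.norm_one] at hw
    omega
  | [s], _, _ => exact ⟨s, by simp [lift_mk, letterValue]⟩
  | s :: t :: L, hw, hL =>
    obtain ⟨hst, hL'⟩ : (s.1 = t.1 → s.2 = t.2) ∧ FreeGroup.IsReduced (t :: L) := by
      simpa [FreeGroup.IsReduced] using hL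
    obtain ⟨h1, h2⟩ := hf.gromovProduct_lift t L hL'
    have h3 := (hf.gromovProduct_lift s (t :: L) hL).1
    have h4 := h2 s hst
    have h5 := gromovProduct_inv_left (letterValue f s) (lift f (FreeGroup.mk (t :: L)))
    rw [letterValue, ← lift_mk_cons, ← letterValue] at h5
    have h6 := hf.le_left s t hst
    -- Here `s` has length 1, so the cancellation is at most 1; being even, it is 0, and the tail
    -- would have to be trivial.
    obtain ⟨p, -, -, h7⟩ := exists_gromovProduct_eq (letterValue f s)⁻¹ (letterValue f t)
    have h8 := hf.norm_pos s
    have h9 := hf.norm_pos t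
    omega

end NielsenReduced

/-! ### Christoffel pairs and their stability under Nielsen moves. -/

section Bases

/-- The free group of rank two. -/
abbrev F₂ : Type := FreeGroup (Fin 2)

/-- The pairs obtained from a pair of signed generators by repeatedly multiplying one entry by the
other. -/
inductive ChristoffelPair : F₂ → F₂ → Prop
  | generators (ε δ : Bool) : ChristoffelPair (FreeGroup.mk [(0, ε)]) (FreeGroup.mk [(1, δ)])
  | generators_swap (ε δ : Bool) : ChristoffelPair (FreeGroup.mk [(1, δ)]) (FreeGroup.mk [(0, ε)])
  | left_mul {a b : F₂} : ChristoffelPair a b → ChristoffelPair a (a * b)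
  | mul_left {a b : F₂} : ChristoffelPair a b → ChristoffelPair a (b * a)
  | mul_right {a b : F₂} : ChristoffelPair a b → ChristoffelPair (a * b) b
  | right_mul {a b : F₂} : ChristoffelPair a b → ChristoffelPair (b * a) b

theorem ChristoffelPair.swap {a b : F₂} (h : ChristoffelPair a b) : ChristoffelPair b a := by
  induction h with
  | generators ε δ => exact .generators_swap ε δ
  | generators_swap ε δ => exact .generators ε δ
  | left_mul _ ih => exact .right_mul ih
  | mul_left _ ih => exact .mul_right ih
  | mul_right _ ih => exact .mul_left ih
  | right_mul _ ih => exact .left_mul ih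

/-- A pair that becomes a Christoffel pair after a simultaneous conjugation and inverting entries. -/
def IsStandard (a b : F₂) : Prop :=
  ∃ h a' b', ChristoffelPair a' b' ∧ (h * a * h⁻¹ = a' ∨ h * a * h⁻¹ = a'⁻¹) ∧
    (h * b * h⁻¹ = b' ∨ h * b * h⁻¹ = b'⁻¹)

theorem ChristoffelPair.isStandard {a b : F₂} (h : ChristoffelPair a b) : IsStandard a b :=
  ⟨1, a, b, h, by simp, by simp⟩

theorem IsStandard.swap {a b : F₂} (h : IsStandard a b) : IsStandard b a := by
  obtain ⟨h, a', b', h', ha, hb⟩ := h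
  exact ⟨h, b', a', h'.swap, hb, ha⟩

theorem IsStandard.of_conj {a b : F₂} (k : F₂) (h : IsStandard (k * a * k⁻¹) (k * b * k⁻¹)) :
    IsStandard a b := by
  obtain ⟨h, a', b', h', ha, hb⟩ := h
  refine ⟨h * k, a', b', h', ?_, ?_⟩
  · simpa [mul_assoc] using ha
  · simpa [mul_assoc] using hb

theorem IsStandard.conj {a b : F₂} (k : F₂) (h : IsStandard a b) :
    IsStandard (k * a * k⁻¹) (k * b * k⁻¹) := by
  apply IsStandard.of_conj k⁻¹
  simpa [mul_assoc] using h

theorem IsStandard.inv_left {a b : F₂} (h : IsStandard a b) : IsStandard a⁻¹ b := by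
  obtain ⟨h, a', b', h', ha, hb⟩ := h
  refine ⟨h, a', b', h', ?_, hb⟩
  rw [← conj_inv]
  rcases ha with ha | ha <;> simp [ha]

theorem IsStandard.inv_right {a b : F₂} (h : IsStandard a b) : IsStandard a b⁻¹ :=
  h.swap.inv_left.swap

/-- Up to conjugation and inversion, the move either undoes the last step of the construction or is
again a positive step; for generators, flip the sign of one of them. -/
theorem ChristoffelPair.isStandard_inv_mul {a b : F₂} (h : ChristoffelPair a b) :
    IsStandard a (a⁻¹ * b) := by
  cases h with
  | generators ε δ =>
    have := (ChristoffelPair.generators (!ε) δ).left_mul.isStandard.inv_left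
    simpa [inv_mk, invRev] using this
  | generators_swap ε δ =>
    have := (ChristoffelPair.generators_swap ε (!δ)).left_mul.isStandard.inv_left
    simpa [inv_mk, invRev] using this
  | left_mul h => simpa using h.isStandard
  | mul_left h =>
    apply IsStandard.of_conj a
    simpa [mul_assoc] using h.isStandard
  | @mul_right a b h =>
    apply IsStandard.of_conj b
    simpa [mul_assoc] using h.swap.mul_right.isStandard.inv_right
  | right_mul h => simpa using h.swap.mul_right.isStandard.inv_right

theorem IsStandard.mul {a b : F₂} (h : IsStandard a b) : IsStandard a (a * b) := by
  obtain ⟨h, a', b', h', ha, hb⟩ := h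
  apply IsStandard.of_conj h
  rw [conj_mul.symm]
  rcases ha with ha | ha <;> rcases hb with hb | hb <;> rw [ha, hb]
  · exact h'.left_mul.isStandard
  · simpa [mul_assoc] using h'.isStandard_inv_mul.inv_right.conj a'
  · exact h'.isStandard_inv_mul.inv_left
  · simpa using h'.mul_left.isStandard.inv_left.inv_right

theorem IsStandard.of_mul {a b : F₂} (h : IsStandard a (a * b)) : IsStandard a b := by
  simpa using h.inv_left.mul.inv_left

theorem IsStandard.of_mul_right {a b : F₂} (h : IsStandard a (b * a)) : IsStandard a b := by
  apply IsStandard.of_mul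
  apply IsStandard.of_conj a⁻¹
  simpa [mul_assoc] using h

theorem IsStandard.of_mul_left {a b : F₂} (h : IsStandard (a * b) b) : IsStandard a b :=
  h.swap.of_mul_right.swap

end Bases

/-! ### Every generating pair is standard, by a minimal counterexample. -/

section MinimalPairs

theorem closure_pair_eq_top {G : Type} [Group G] {a b c d : G}
    (h : Subgroup.closure {a, b} = ⊤) (ha : a ∈ Subgroup.closure {c, d})
    (hb : b ∈ Subgroup.closure {c, d}) : Subgroup.closure {c, d} = ⊤ := by
  rw [eq_top_iff, ← h, Subgroup.closure_le]
  rintro g (rfl | rfl) <;> assumption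

theorem left_mem_closure_pair {G : Type} [Group G] (a b : G) : a ∈ Subgroup.closure {a, b} :=
  Subgroup.subset_closure (by simp)

theorem right_mem_closure_pair {G : Type} [Group G] (a b : G) : b ∈ Subgroup.closure {a, b} :=
  Subgroup.subset_closure (by simp)

theorem closure_pair_left_mul_eq_top {G : Type} [Group G] {a b : G}
    (h : Subgroup.closure {a, b} = ⊤) : Subgroup.closure {a, a * b} = ⊤ := by
  refine closure_pair_eq_top h (left_mem_closure_pair _ _) ?_
  simpa using mul_mem (inv_mem (left_mem_closure_pair a (a * b))) (right_mem_closure_pair a (a * b))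

theorem closure_pair_conj_eq_top {G : Type} [Group G] {a b : G} (k : G)
    (h : Subgroup.closure {a, b} = ⊤) :
    Subgroup.closure {k * a * k⁻¹, k * b * k⁻¹} = ⊤ := by
  have := congrArg (Subgroup.map (MulAut.conj k).toMonoidHom) h
  rw [MonoidHom.map_closure, Set.image_pair,
    Subgroup.map_top_of_surjective _ (MulAut.conj k).surjective] at this
  simpa using this

/-- A generating pair of minimal total length among those that are not standard. -/
structure IsMinimalNonstandard (a b : F₂) : Prop where
  closure_eq : Subgroup.closure {a, b} = ⊤
  not_isStandard : ¬ IsStandard a b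
  isStandard_of_lt : ∀ c d : F₂, Subgroup.closure {c, d} = ⊤ →
    c.norm + d.norm < a.norm + b.norm → IsStandard c d

namespace IsMinimalNonstandard

variable {a b : F₂}

theorem swap (h : IsMinimalNonstandard a b) : IsMinimalNonstandard b a where
  closure_eq := by rw [Set.pair_comm, h.closure_eq]
  not_isStandard h' := h.not_isStandard h'.swap
  isStandard_of_lt c d hc hlt := h.isStandard_of_lt c d hc (by omega)

theorem inv_left (h : IsMinimalNonstandard a b) : IsMinimalNonstandard a⁻¹ b where
  closure_eq := by
    refine closure_pair_eq_top h.closure_eq ?_ (right_mem_closure_pair _ _)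
    simpa using inv_mem (left_mem_closure_pair a⁻¹ b)
  not_isStandard h' := h.not_isStandard (by simpa using h'.inv_left)
  isStandard_of_lt c d hc hlt := h.isStandard_of_lt c d hc (by rwa [norm_inv_eq] at hlt)

theorem inv_right (h : IsMinimalNonstandard a b) : IsMinimalNonstandard a b⁻¹ :=
  h.swap.inv_left.swap

theorem ne_one (h : IsMinimalNonstandard a b) : a ≠ 1 := by
  rintro rfl
  have hcl := h.closure_eq
  have hz : ∀ g : F₂, g ∈ Subgroup.zpowers b := by
    intro g
    have : g ∈ Subgroup.closure {1, b} := hcl ▸ Subgroup.mem_top g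
    rwa [Subgroup.closure_insert_one, ← Subgroup.zpowers_eq_closure] at this
  obtain ⟨m, hm⟩ := Subgroup.mem_zpowers_iff.1 (hz x)
  obtain ⟨n, hn⟩ := Subgroup.mem_zpowers_iff.1 (hz y)
  have : x * y = y * x := by rw [← hm, ← hn, ← zpow_add, ← zpow_add, add_comm]
  revert this
  decide

theorem norm_right_le (h : IsMinimalNonstandard a b) : b.norm ≤ (a * b).norm := by
  by_contra! hlt
  exact h.not_isStandard (h.isStandard_of_lt a (a * b)
    (closure_pair_left_mul_eq_top h.closure_eq) (by omega)).of_mul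

theorem norm_left_le (h : IsMinimalNonstandard a b) : a.norm ≤ (a * b).norm := by
  by_contra! hlt
  refine h.not_isStandard (h.isStandard_of_lt (a * b) b ?_ (by omega)).of_mul_left
  refine closure_pair_eq_top h.closure_eq ?_ (right_mem_closure_pair _ _)
  simpa using mul_mem (left_mem_closure_pair (a * b) b) (inv_mem (right_mem_closure_pair (a * b) b))

theorem gromovProduct_le_left (h : IsMinimalNonstandard a b) :
    gromovProduct a⁻¹ b ≤ a.norm := by
  rw [gromovProduct_inv_left]
  have := h.norm_right_le
  omega

theorem gromovProduct_le_right (h : IsMinimalNonstandard a b) :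
    gromovProduct a⁻¹ b ≤ b.norm := by
  rw [gromovProduct_inv_left]
  have := h.norm_left_le
  omega

/-- If `a` cancels completely against two neighbours, then both halves are prefixes. -/
theorem exists_halves (h : IsMinimalNonstandard a b) {c : F₂} (hc : IsMinimalNonstandard a c)
    (hle : 2 * (a.norm : ℤ) ≤ gromovProduct b⁻¹ a + gromovProduct a⁻¹ c) :
    ∃ p q : List (Fin 2 × Bool), p.length = q.length ∧ a.toWord = p ++ invRev q ∧
      p <+: b⁻¹.toWord ∧ q <+: c.toWord := by
  have h1 := h.swap.gromovProduct_le_right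
  have h2 := hc.gromovProduct_le_left
  obtain ⟨p, ⟨s, hs⟩, hp', hp⟩ := by
    have := exists_gromovProduct_eq a b⁻¹
    rwa [gromovProduct_comm] at this
  obtain ⟨q, ⟨t, ht⟩, hq', hq⟩ := exists_gromovProduct_eq a⁻¹ c
  refine ⟨p, q, by omega, ?_, hp', hq'⟩
  have ht' : a.toWord = invRev t ++ invRev q := by
    rw [← invRev_append, ht, toWord_inv, invRev_invRev]
  have hla := congrArg List.length ht'
  have hn : a.norm = a.toWord.length := rfl
  simp only [List.length_append, invRev_length] at hla
  rw [ht'] at hs ⊢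
  rw [(List.append_inj hs (by simp; omega)).1]

/-- Otherwise both halves are prefixes of `b⁻¹` of equal length, hence equal, and `a = 1`. -/
theorem gromovProduct_add_lt_inv (h : IsMinimalNonstandard a b) :
    gromovProduct b⁻¹ a + gromovProduct a⁻¹ b⁻¹ < 2 * a.norm := by
  by_contra! hle
  obtain ⟨p, q, hpq, ha, hp, hq⟩ := h.exists_halves h.inv_right hle
  have hpq : p = q := (List.prefix_of_prefix_length_le hp hq hpq.le).eq_of_length hpq
  apply h.ne_one
  rw [← mk_toWord (x := a), ha, hpq, ← mul_mk, ← inv_mk, mul_inv_cancel]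

/-- Otherwise `a = P Q⁻¹` and `b = Q m P⁻¹` with `P`, `Q` of equal length. Conjugating `(a, a * b)`
by `P⁻¹` gives `(Q⁻¹ P, m)`, of total length at most `|b|`. Conjugation here replaces the usual
tie-breaking order on words. -/
theorem gromovProduct_add_lt (h : IsMinimalNonstandard a b) :
    gromovProduct b⁻¹ a + gromovProduct a⁻¹ b < 2 * a.norm := by
  by_contra! hle
  obtain ⟨p, q, hpq, ha, ⟨s, hs⟩, ⟨t, ht⟩⟩ := h.exists_halves h hle
  have hb : b.toWord = invRev s ++ invRev p := by
    rw [← invRev_append, hs, toWord_inv, invRev_invRev]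
  have hla : a.norm = p.length + q.length := by
    rw [FreeGroup.norm, ha, List.length_append, invRev_length]
  have hlb : b.norm = s.length + p.length := by
    rw [FreeGroup.norm, hb, List.length_append, invRev_length, invRev_length]
  have hab : 2 * p.length ≤ b.norm := by
    have h1 := h.swap.gromovProduct_le_left
    have h2 := h.gromovProduct_le_left
    omega
  -- Since `2|p| ≤ |b|`, the prefix `q` and the suffix `p⁻¹` of `b` do not overlap.
  obtain ⟨m, hm⟩ : q <+: invRev s := by
    refine List.prefix_of_prefix_length_le (l₃ := b.toWord) ⟨t, ht⟩ ⟨_, hb.symm⟩ ?_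
    rw [invRev_length]
    omega
  have hlm := congrArg List.length hm
  rw [List.length_append, invRev_length] at hlm
  set P : F₂ := FreeGroup.mk p
  set Q : F₂ := FreeGroup.mk q
  have haPQ : a = P * Q⁻¹ := by
    rw [← mk_toWord (x := a), ha, ← mul_mk, ← inv_mk]
  have hbQP : b = Q * FreeGroup.mk m * P⁻¹ := by
    rw [← mk_toWord (x := b), hb, ← hm, ← mul_mk, ← mul_mk, ← inv_mk]
  have e1 : P⁻¹ * a * P⁻¹⁻¹ = Q⁻¹ * P := by
    rw [haPQ]
    group
  have e2 : P⁻¹ * (a * b) * P⁻¹⁻¹ = FreeGroup.mk m := by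
    rw [haPQ, hbQP]
    group
  have n1 : (Q⁻¹ * P).norm ≤ q.length + p.length := by
    refine (FreeGroup.norm_mul_le _ _).trans ?_
    rw [norm_inv_eq]
    exact add_le_add norm_mk_le norm_mk_le
  have n2 : (FreeGroup.mk m).norm ≤ m.length := norm_mk_le
  have hpos : 0 < a.norm := Nat.pos_of_ne_zero fun h0 => h.ne_one (norm_eq_zero.1 h0)
  refine h.not_isStandard (IsStandard.of_mul (IsStandard.of_conj P⁻¹ ?_))
  rw [e1, e2]
  refine h.isStandard_of_lt _ _ ?_ (by omega)
  rw [← e1, ← e2]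
  exact closure_pair_conj_eq_top P⁻¹ (closure_pair_left_mul_eq_top h.closure_eq)

theorem letterValue (h : IsMinimalNonstandard a b) {s t : Fin 2 × Bool} (hst : s.1 ≠ t.1) :
    IsMinimalNonstandard (letterValue ![a, b] s) (letterValue ![a, b] t) := by
  obtain ⟨s, ε⟩ := s
  obtain ⟨t, δ⟩ := t
  fin_cases s <;> fin_cases t <;> simp at hst <;> cases ε <;> cases δ <;>
    simp [FreeGroupWords.letterValue] <;>
    first
    | exact h | exact h.inv_left | exact h.inv_right | exact h.inv_left.inv_right
    | exact h.swap | exact h.swap.inv_left | exact h.swap.inv_right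
    | exact h.swap.inv_left.inv_right

theorem nielsenReduced (h : IsMinimalNonstandard a b) : NielsenReduced ![a, b] := by
  have hself : ∀ s : Fin 2 × Bool, gromovProduct (FreeGroupWords.letterValue ![a, b] s)⁻¹
      (FreeGroupWords.letterValue ![a, b] s) < (FreeGroupWords.letterValue ![a, b] s).norm := by
    intro s
    rw [gromovProduct_inv_left]
    have := norm_lt_norm_mul_self
      (h.letterValue (s := s) (t := (s.1 + 1, true)) (by simp)).ne_one
    omega
  have hl : ∀ s t : Fin 2 × Bool, (s.1 = t.1 → s.2 = t.2) →
      gromovProduct (FreeGroupWords.letterValue ![a, b] s)⁻¹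
        (FreeGroupWords.letterValue ![a, b] t) ≤ (FreeGroupWords.letterValue ![a, b] s).norm := by
    intro s t hst
    by_cases h' : s.1 = t.1
    · obtain rfl : s = t := Prod.ext h' (hst h')
      exact (hself s).le
    · exact (h.letterValue h').gromovProduct_le_left
  have hr : ∀ s t : Fin 2 × Bool, (s.1 = t.1 → s.2 = t.2) →
      gromovProduct (FreeGroupWords.letterValue ![a, b] s)⁻¹
        (FreeGroupWords.letterValue ![a, b] t) ≤ (FreeGroupWords.letterValue ![a, b] t).norm := by
    intro s t hst
    by_cases h' : s.1 = t.1
    · obtain rfl : s = t := Prod.ext h' (hst h')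
      exact (hself s).le
    · exact (h.letterValue h').gromovProduct_le_right
  refine ⟨hl, hr, fun r s t hrs hst => ?_⟩
  by_cases h1 : r.1 = s.1
  · obtain rfl : r = s := Prod.ext h1 (hrs h1)
    have := hself r
    have := hl r t hst
    omega
  by_cases h2 : s.1 = t.1
  · obtain rfl : s = t := Prod.ext h2 (hst h2)
    have := hself s
    have := hr r s hrs
    omega
  have h3 : r.1 = t.1 := by omega
  have hsr := h.letterValue (Ne.symm h1)
  by_cases h4 : r.2 = t.2
  · obtain rfl : r = t := Prod.ext h3 h4
    exact hsr.gromovProduct_add_lt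
  · have : FreeGroupWords.letterValue ![a, b] t = (FreeGroupWords.letterValue ![a, b] r)⁻¹ := by
      obtain ⟨r, ε⟩ := r
      obtain ⟨t, δ⟩ := t
      simp only at h3 h4
      subst h3
      cases ε <;> cases δ <;> simp [FreeGroupWords.letterValue] at h4 ⊢
    rw [this]
    exact hsr.gromovProduct_add_lt_inv

/-- The generators `x` and `y` have length 1, so they must be letters of the family; thus `(a, b)`
is `(x, y)` up to order and signs, which is standard. -/
theorem false (h : IsMinimalNonstandard a b) : False := by
  have hsurj : ∀ g : F₂, ∃ w, lift ![a, b] w = g := by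
    intro g
    have hg : g ∈ Subgroup.closure {a, b} := h.closure_eq ▸ Subgroup.mem_top g
    have hle : Subgroup.closure {a, b} ≤ (lift ![a, b]).range := by
      rw [Subgroup.closure_le]
      rintro g (rfl | rfl)
      · exact ⟨FreeGroup.of 0, by simp⟩
      · exact ⟨FreeGroup.of 1, by simp⟩
    exact hle hg
  obtain ⟨v, hv⟩ := hsurj x
  obtain ⟨w, hw⟩ := hsurj y
  obtain ⟨s, hs⟩ := h.nielsenReduced.exists_letterValue_eq v (by rw [hv, x, norm_of])
  obtain ⟨t, ht⟩ := h.nielsenReduced.exists_letterValue_eq w (by rw [hw, y, norm_of])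
  rw [hv] at hs
  rw [hw] at ht
  have hxy : IsStandard x y := (ChristoffelPair.generators true true).isStandard
  by_cases hst : s.1 = t.1
  · have : x = y ∨ x = y⁻¹ := by
      obtain ⟨s, ε⟩ := s
      obtain ⟨t, δ⟩ := t
      simp only at hst
      subst hst
      rw [hs, ht]
      cases ε <;> cases δ <;> simp [FreeGroupWords.letterValue]
    revert this
    decide
  · have := h.letterValue hst
    rw [← hs, ← ht] at this
    exact this.not_isStandard hxy

end IsMinimalNonstandard

theorem isStandard_of_closure_eq_top {a b : F₂} (h : Subgroup.closure {a, b} = ⊤) :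
    IsStandard a b := by
  induction hn : a.norm + b.norm using Nat.strong_induction_on generalizing a b with
  | _ n ih =>
    by_contra hns
    exact IsMinimalNonstandard.false (a := a) (b := b)
      ⟨h, hns, fun c d hcd hlt => ih _ (hn ▸ hlt) hcd rfl⟩

end MinimalPairs

/-! ### Conjugacy classes of words with one sign per generator. -/

section Coherent

variable {α : Type}

/-- A word is coherent with a choice of signs if every letter occurs with its chosen sign only. -/
def Coherent (ε : α → Bool) (L : List (α × Bool)) : Prop := ∀ s ∈ L, s.2 = ε s.1

theorem Coherent.isReduced {ε : α → Bool} {L : List (α × Bool)} (h : Coherent ε L) :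
    FreeGroup.IsReduced L := by
  rw [FreeGroup.IsReduced]
  refine List.Pairwise.isChain (List.pairwise_of_forall_mem_list ?_)
  intro a ha b hb hab
  rw [h a ha, h b hb, hab]

theorem Coherent.of_isRotated {ε : α → Bool} {L L' : List (α × Bool)} (h : Coherent ε L)
    (hL : L' ~r L) : Coherent ε L' := fun s hs => h s (hL.mem_iff.1 hs)

variable [DecidableEq α]

theorem Coherent.toWord_mul {ε : α → Bool} {a b : FreeGroup α} (ha : Coherent ε a.toWord)
    (hb : Coherent ε b.toWord) : Coherent ε (a * b).toWord := by
  intro s hs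
  rcases List.mem_append.1 ((toWord_mul_sublist a b).subset hs) with h | h
  exacts [ha s h, hb s h]

theorem Coherent.toWord_inv {ε : α → Bool} {a : FreeGroup α} (ha : Coherent ε a.toWord) :
    Coherent (fun i => !ε i) a⁻¹.toWord := by
  intro s hs
  rw [FreeGroup.toWord_inv, invRev, List.mem_reverse, List.mem_map] at hs
  obtain ⟨t, ht, rfl⟩ := hs
  simp [ha t ht]

theorem snd_eq_of_ne_inv {α : Type} {s : α × Bool} {i : α} {b : Bool} (h : s ≠ (i, !b)) :
    i = s.1 → b = s.2 := by
  obtain ⟨j, c⟩ := s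
  rintro rfl
  cases b <;> cases c <;> simp at h ⊢

theorem toWord_eq_of_eq_mk {g : FreeGroup α} {L : List (α × Bool)} (h : g = FreeGroup.mk L)
    (hL : FreeGroup.IsReduced L) : g.toWord = L := by
  rw [h, toWord_mk_of_isReduced hL]

/-- The new letter either lengthens `t`, cancels its first letter, or, if `t` is empty, may rotate
`L`. Coherence keeps rotations of `L` reduced. -/
theorem exists_toWord_conj_letter {ε : α → Bool} {g : FreeGroup α} {t L : List (α × Bool)}
    (hg : g.toWord = t ++ L ++ invRev t) (hL : Coherent ε L) (z : α × Bool) :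
    ∃ t' L', (FreeGroup.mk [z] * g * (FreeGroup.mk [z])⁻¹).toWord = t' ++ L' ++ invRev t' ∧
      L' ~r L := by
  have hred : FreeGroup.IsReduced (t ++ L ++ invRev t) := hg ▸ isReduced_toWord
  have hgm : g = FreeGroup.mk (t ++ L ++ invRev t) := by rw [← hg, mk_toWord]
  obtain ⟨i, b⟩ := z
  have hz : (FreeGroup.mk [(i, b)])⁻¹ = FreeGroup.mk [(i, !b)] := by simp [inv_mk, invRev]
  cases t with
  | cons z' t =>
    obtain ⟨j, c⟩ := z'
    by_cases hzz : j = i ∧ c = !b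
    · obtain ⟨rfl, rfl⟩ := hzz
      refine ⟨t, L, toWord_eq_of_eq_mk ?_ (hred.infix ⟨[(j, !b)], [(j, b)], by simp [invRev]⟩),
        List.IsRotated.refl L⟩
      have : FreeGroup.mk ((j, !b) :: t ++ L ++ invRev ((j, !b) :: t)) =
          (FreeGroup.mk [(j, b)])⁻¹ * FreeGroup.mk (t ++ L ++ invRev t) *
            FreeGroup.mk [(j, b)] := by
        rw [hz, mul_mk, mul_mk]
        simp [invRev]
      rw [hgm, this]
      group
    · refine ⟨(i, b) :: (j, c) :: t, L, toWord_eq_of_eq_mk ?_ ?_, List.IsRotated.refl L⟩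
      · rw [hgm, hz, mul_mk, mul_mk]
        simp [invRev]
      · have : (i, b) :: (j, c) :: t ++ L ++ invRev ((i, b) :: (j, c) :: t) =
            [(i, b)] ++ (((j, c) :: t ++ L ++ invRev ((j, c) :: t)) ++ [(i, !b)]) := by
          simp [invRev]
        rw [this, isReduced_append, isReduced_append]
        refine ⟨by simp, ⟨hred, by simp, ?_⟩, ?_⟩
        · have : ((j, c) :: t ++ L ++ invRev ((j, c) :: t)).getLast? = some (j, !c) := by
            rw [invRev_cons, ← List.append_assoc]
            exact List.getLast?_concat
          intro u hu v hv huv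
          rw [this] at hu
          simp at hu hv
          subst hu hv
          have := snd_eq_of_ne_inv (s := (j, c)) (i := i) (b := b) (by simpa using hzz) huv.symm
          simp at this
          simp [this]
        · intro u hu v hv
          simp at hu hv
          subst hu hv
          exact snd_eq_of_ne_inv (by simpa using hzz)
  | nil =>
    simp only [List.nil_append, invRev_empty, List.append_nil] at hred hgm
    cases L with
    | nil =>
      refine ⟨[], [], ?_, List.IsRotated.refl _⟩
      rw [hgm, ← one_eq_mk, mul_one, mul_inv_cancel]
      rfl
    | cons l L =>
      by_cases hl : l = (i, !b)
      · subst hl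
        refine ⟨[], L ++ [(i, !b)], toWord_eq_of_eq_mk ?_ ?_, List.isRotated_concat _ _⟩
        · have : FreeGroup.mk ((i, !b) :: L) = (FreeGroup.mk [(i, b)])⁻¹ * FreeGroup.mk L := by
            rw [hz, mul_mk]
            simp
          rw [hgm, this, mul_inv_cancel_left, hz, mul_mk]
          simp
        · simpa using (hL.of_isRotated (List.isRotated_concat (i, !b) L)).isReduced
      · rcases List.eq_nil_or_concat (l :: L) with h | ⟨L', l', h⟩
        · simp at h
        rw [List.concat_eq_append] at h
        by_cases hl' : l' = (i, b)
        · subst hl'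
          rw [h] at hgm hL ⊢
          have hrot := (List.isRotated_concat (i, b) L').symm
          refine ⟨[], (i, b) :: L', toWord_eq_of_eq_mk ?_ ?_, hrot⟩
          · rw [hgm, ← mul_mk, mul_assoc, mul_assoc, mul_inv_cancel, mul_one, mul_mk]
            simp
          · simpa using (hL.of_isRotated hrot).isReduced
        · refine ⟨[(i, b)], l :: L, toWord_eq_of_eq_mk ?_ ?_, List.IsRotated.refl _⟩
          · rw [hgm, hz, mul_mk, mul_mk]
            simp [invRev]
          · have : [(i, b)] ++ l :: L ++ invRev [(i, b)] =
              [(i, b)] ++ ((l :: L) ++ [(i, !b)]) := by simp [invRev]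
            rw [this, isReduced_append, isReduced_append]
            refine ⟨by simp, ⟨hred, by simp, ?_⟩, ?_⟩
            · rw [h]
              intro u hu v hv huv
              simp at hu hv
              subst hu hv
              exact (snd_eq_of_ne_inv (i := i) (b := !b) (by simpa using hl')
                huv.symm).symm
            · intro u hu v hv
              simp at hu hv
              subst hu hv
              exact snd_eq_of_ne_inv hl

theorem Coherent.exists_toWord_of_isConj {ε : α → Bool} {c g : FreeGroup α}
    (hc : Coherent ε c.toWord) (h : IsConj c g) :
    ∃ t L, g.toWord = t ++ L ++ invRev t ∧ L ~r c.toWord := by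
  obtain ⟨k, rfl⟩ := isConj_iff.1 h
  rw [← mk_toWord (x := k)]
  induction k.toWord with
  | nil => exact ⟨[], c.toWord, by simp [← one_eq_mk], List.IsRotated.refl _⟩
  | cons z K ih =>
    obtain ⟨t, L, hg, hL⟩ := ih
    obtain ⟨t', L', hg', hL'⟩ := exists_toWord_conj_letter hg (hc.of_isRotated hL) z
    refine ⟨t', L', ?_, hL'.trans hL⟩
    rw [← hg', ← List.singleton_append, ← mul_mk]
    congr 1
    group

theorem Coherent.isRotated_of_norm_eq {ε : α → Bool} {c g : FreeGroup α}
    (hc : Coherent ε c.toWord) (h : IsConj c g) (hn : g.norm = c.norm) :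
    g.toWord ~r c.toWord := by
  obtain ⟨t, L, hg, hL⟩ := hc.exists_toWord_of_isConj h
  have h1 := congrArg List.length hg
  have h2 := hL.perm.length_eq
  simp only [FreeGroup.norm] at hn
  simp only [List.length_append, invRev_length] at h1
  obtain rfl : t = [] := List.length_eq_zero_iff.1 (by omega)
  simpa [hg] using hL

theorem Coherent.isRotated_of_isPalindrome {ε : α → Bool} {c g : FreeGroup α}
    (hc : Coherent ε c.toWord) (h : IsConj c g) (hg' : IsPalindrome g) :
    g.toWord ~r c.toWord := by
  obtain ⟨t, L, hg, hL⟩ := hc.exists_toWord_of_isConj h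
  cases t with
  | nil => simpa [hg] using hL
  | cons z t =>
    have := hg'.reverse_eq
    rw [hg] at this
    simp [invRev] at this
    have := congrArg Prod.snd this.1
    simp at this

theorem isConj_mk_of_isRotated {c : FreeGroup α} {L : List (α × Bool)} (h : L ~r c.toWord) :
    IsConj c (FreeGroup.mk L) := by
  obtain ⟨n, rfl⟩ := h.symm
  induction n with
  | zero => rw [List.rotate_zero, mk_toWord]
  | succ n ih =>
    refine ih (List.IsRotated.forall _ _) |>.trans ?_
    rw [← List.rotate_rotate]
    cases c.toWord.rotate n with
    | nil => exact IsConj.refl _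
    | cons z L =>
      rw [isConj_iff]
      refine ⟨(FreeGroup.mk [z])⁻¹, ?_⟩
      have : FreeGroup.mk (z :: L) = FreeGroup.mk [z] * FreeGroup.mk L := by rw [mul_mk]; rfl
      rw [inv_inv, this, inv_mul_cancel_left, mul_mk]
      simp

end Coherent

/-! ### The reversal anti-automorphism. -/

section Reversal

variable {α : Type}

/-- The anti-automorphism of a free group that fixes the generators. -/
def reversal (g : FreeGroup α) : FreeGroup α :=
  (lift (fun i => MulOpposite.op (FreeGroup.of i)) g).unop

theorem reversal_mul (a b : FreeGroup α) : reversal (a * b) = reversal b * reversal a := by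
  simp [reversal]

theorem reversal_inv (a : FreeGroup α) : reversal a⁻¹ = (reversal a)⁻¹ := by
  simp [reversal]

theorem reversal_mk (L : List (α × Bool)) : reversal (FreeGroup.mk L) = FreeGroup.mk L.reverse := by
  induction L with
  | nil => simp [reversal, ← one_eq_mk]
  | cons s L ih =>
    rw [List.reverse_cons, ← mul_mk, ← ih, ← List.singleton_append, ← mul_mk, reversal_mul]
    congr 1
    obtain ⟨i, b⟩ := s
    cases b
    · have : FreeGroup.mk [(i, false)] = (FreeGroup.of i)⁻¹ := rfl
      simp [this, reversal]
    · have : FreeGroup.mk [(i, true)] = FreeGroup.of i := rfl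
      simp [this, reversal]

end Reversal

/-! ### Primitive elements: coherent representatives and coprime exponent sums. -/

section Primitive

/-- One conjugator must serve both entries for the induction to run: `reversal (a * b)` is the
conjugate by `g` of `b * a`, and multiplying `g` by `a⁻¹` corrects this without affecting `a`. -/
theorem ChristoffelPair.exists_reversal_eq {a b : F₂} (h : ChristoffelPair a b) :
    ∃ g, reversal a = g * a * g⁻¹ ∧ reversal b = g * b * g⁻¹ := by
  induction h with
  | generators => exact ⟨1, by simp [reversal_mk], by simp [reversal_mk]⟩
  | generators_swap => exact ⟨1, by simp [reversal_mk], by simp [reversal_mk]⟩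
  | @left_mul a b _ ih =>
    obtain ⟨g, ha, hb⟩ := ih
    exact ⟨g * a⁻¹, by rw [ha]; group, by rw [reversal_mul, ha, hb]; group⟩
  | @mul_left a b _ ih =>
    obtain ⟨g, ha, hb⟩ := ih
    exact ⟨g * a, by rw [ha]; group, by rw [reversal_mul, ha, hb]; group⟩
  | @mul_right a b _ ih =>
    obtain ⟨g, ha, hb⟩ := ih
    exact ⟨g * b, by rw [reversal_mul, ha, hb]; group, by rw [hb]; group⟩
  | @right_mul a b _ ih =>
    obtain ⟨g, ha, hb⟩ := ih
    exact ⟨g * b⁻¹, by rw [reversal_mul, ha, hb]; group, by rw [hb]; group⟩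

theorem ChristoffelPair.exists_coherent {a b : F₂} (h : ChristoffelPair a b) :
    ∃ ε, Coherent ε a.toWord ∧ Coherent ε b.toWord := by
  induction h with
  | generators ε δ => exact ⟨![ε, δ], by simp [Coherent], by simp [Coherent]⟩
  | generators_swap ε δ => exact ⟨![ε, δ], by simp [Coherent], by simp [Coherent]⟩
  | left_mul _ ih => exact ih.imp fun _ h => ⟨h.1, h.1.toWord_mul h.2⟩
  | mul_left _ ih => exact ih.imp fun _ h => ⟨h.1, h.2.toWord_mul h.1⟩
  | mul_right _ ih => exact ih.imp fun _ h => ⟨h.1.toWord_mul h.2, h.2⟩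
  | right_mul _ ih => exact ih.imp fun _ h => ⟨h.2.toWord_mul h.1, h.2⟩

theorem IsStandard.exists_coherent {a b : F₂} (h : IsStandard a b) :
    ∃ c ε, IsConj a c ∧ Coherent ε c.toWord ∧ IsConj c (reversal c) := by
  obtain ⟨k, a', b', h', ha, -⟩ := h
  obtain ⟨ε, hε, -⟩ := h'.exists_coherent
  obtain ⟨g, hg, -⟩ := h'.exists_reversal_eq
  rcases ha with ha | ha
  · exact ⟨a', ε, isConj_iff.2 ⟨k, ha⟩, hε, isConj_iff.2 ⟨g, hg.symm⟩⟩
  · refine ⟨a'⁻¹, _, isConj_iff.2 ⟨k, ha⟩, hε.toWord_inv, isConj_iff.2 ⟨g, ?_⟩⟩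
    rw [reversal_inv, hg]
    group

theorem IsPrimitive.exists_closure_eq_top {p : F₂} (hp : IsPrimitive p) :
    ∃ q, Subgroup.closure {p, q} = ⊤ := by
  obtain ⟨ι, b, i, rfl⟩ := hp
  have e : ι ≃ Fin 2 := Equiv.ofFreeGroupEquiv b.repr.symm
  have hcl : Subgroup.closure (Set.range b) = ⊤ := by
    have h1 := congrArg (Subgroup.map b.repr.symm.toMonoidHom) (closure_range_of ι)
    rw [MonoidHom.map_closure, Subgroup.map_top_of_surjective _ b.repr.symm.surjective,
      ← Set.range_comp] at h1
    exact h1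
  refine ⟨b (e.symm (e i + 1)), ?_⟩
  rw [eq_top_iff, ← hcl, Subgroup.closure_le]
  rintro _ ⟨j, rfl⟩
  apply Subgroup.subset_closure
  by_cases hij : e j = e i
  · left
    rw [e.injective hij]
  · right
    have : e j = e i + 1 := by omega
    simp [← this]

theorem expSum_mul {α : Type} [DecidableEq α] (i : α) (g h : FreeGroup α) :
    expSum i (g * h) = expSum i g + expSum i h := by
  simp [expSum]

theorem expSum_eq_of_isConj {α : Type} [DecidableEq α] (i : α) {g h : FreeGroup α}
    (hgh : IsConj g h) : expSum i g = expSum i h := by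
  obtain ⟨k, rfl⟩ := isConj_iff.1 hgh
  simp [expSum]

theorem IsPrimitive.isCoprime_expSum {p : F₂} (hp : IsPrimitive p) :
    IsCoprime (expSum 0 p) (expSum 1 p) := by
  obtain ⟨ι, b, i, rfl⟩ := hp
  -- This map takes the value 1 on `p` and factors through the exponent sums, giving a Bézout
  -- relation.
  let f : F₂ →* Multiplicative ℤ := b.lift fun _ => Multiplicative.ofAdd 1
  have hf : ∀ g, (f g).toAdd = (f x).toAdd * expSum 0 g + (f y).toAdd * expSum 1 g := by
    intro g
    induction g using FreeGroup.induction_on with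
    | C1 => simp [expSum]
    | of j => fin_cases j <;> simp [expSum, x, y]
    | inv_of j _ => fin_cases j <;> simp [expSum, x, y]
    | mul g h hg hh =>
      rw [_root_.map_mul, toAdd_mul, hg, hh, expSum_mul, expSum_mul]
      ring
  refine ⟨(f x).toAdd, (f y).toAdd, ?_⟩
  rw [← hf]
  simp [f]

theorem IsPrimitive.exists_coherent {p : F₂} (hp : IsPrimitive p) :
    ∃ c ε, IsConj p c ∧ Coherent ε c.toWord ∧ c.toWord.reverse ~r c.toWord := by
  obtain ⟨q, hq⟩ := hp.exists_closure_eq_top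
  obtain ⟨c, ε, hpc, hc, hrev⟩ := (isStandard_of_closure_eq_top hq).exists_coherent
  have hw : (reversal c).toWord = c.toWord.reverse := by
    refine toWord_eq_of_eq_mk ?_ (Coherent.isReduced (ε := ε) fun s hs => hc s (by simpa using hs))
    rw [← reversal_mk, mk_toWord]
  refine ⟨c, ε, hpc, hc, ?_⟩
  rw [← hw]
  exact hc.isRotated_of_norm_eq hrev (by simp [FreeGroup.norm, hw])

end Primitive

/-! ### Palindromes among the rotations of a cyclic word. -/

section CyclicWords

variable {β : Type}

/-- The Euclidean algorithm on lengths: the shorter word is a prefix of the longer and can be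
stripped. -/
theorem exists_replicate_of_append_comm (u v : List β) (h : u ++ v = v ++ u) :
    ∃ w i j, u = (List.replicate i w).flatten ∧ v = (List.replicate j w).flatten := by
  induction hn : u.length + v.length using Nat.strong_induction_on generalizing u v with
  | _ n ih =>
    wlog hle : u.length ≤ v.length generalizing u v
    · obtain ⟨w, i, j, hi, hj⟩ := this v u h.symm (by omega) (by omega)
      exact ⟨w, j, i, hj, hi⟩
    rcases u.length.eq_zero_or_pos with h0 | hpos
    · exact ⟨v, 0, 1, by simpa using h0, by simp⟩
    · obtain ⟨v', rfl⟩ : u <+: v :=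
        List.prefix_of_prefix_length_le (l₃ := v ++ u) ⟨v, h⟩ ⟨u, rfl⟩ hle
      rw [List.append_assoc, List.append_cancel_left_eq] at h
      rw [List.length_append] at hn
      obtain ⟨w, i, j, hi, hj⟩ := ih _ (by omega) u v' h rfl
      exact ⟨w, i, i + j, hi, by rw [List.replicate_add, List.flatten_append, ← hi, ← hj]⟩

theorem countP_flatten_replicate (p : β → Bool) (w : List β) (k : ℕ) :
    ((List.replicate k w).flatten).countP p = k * w.countP p := by
  simp [List.countP_flatten]

/-- A cyclic word is aperiodic if it is fixed by the trivial rotations only. -/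
def Aperiodic (L : List β) : Prop := ∀ k, L.rotate k = L → L.length ∣ k

/-- A period makes `L` a power `w ^ (i + j)`, and the exponent divides both counts. -/
theorem aperiodic_of_coprime_countP {L : List β} {p q : β → Bool}
    (h : Nat.Coprime (L.countP p) (L.countP q)) : Aperiodic L := by
  intro k hk
  rw [← List.rotate_mod] at hk
  rcases L.length.eq_zero_or_pos with h0 | hpos
  · rw [List.length_eq_zero_iff] at h0
    simp [h0] at h
  have hlt := Nat.mod_lt k hpos
  rw [List.rotate_eq_drop_append_take hlt.le] at hk
  have h1 := List.take_append_drop (k % L.length) L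
  obtain ⟨w, i, j, hi, hj⟩ := exists_replicate_of_append_comm _ _ (h1.trans hk.symm)
  rw [hi, hj, ← List.flatten_append, ← List.replicate_add] at h1
  rw [← h1, countP_flatten_replicate, countP_flatten_replicate] at h
  have hij : i + j = 1 := Nat.eq_one_of_dvd_coprimes h (dvd_mul_right _ _) (dvd_mul_right _ _)
  apply Nat.dvd_of_mod_eq_zero
  have hli := congrArg List.length hi
  have hlj := congrArg List.length hj
  rw [List.length_take] at hli
  rw [List.length_drop] at hlj
  rcases (by omega : i = 0 ∨ j = 0) with rfl | rfl
  · simp only [List.replicate_zero, List.flatten_nil, List.length_nil] at hli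
    omega
  · simp only [List.replicate_zero, List.flatten_nil, List.length_nil] at hlj
    omega

theorem Aperiodic.of_isRotated {L M : List β} (h : Aperiodic L) (hM : M ~r L) : Aperiodic M := by
  obtain ⟨j, rfl⟩ := hM.symm
  intro k hk
  rw [List.rotate_rotate, add_comm, ← List.rotate_rotate, List.rotate_eq_rotate] at hk
  rw [List.length_rotate]
  exact h k hk

theorem Aperiodic.dvd_of_rotate_eq {L : List β} (h : Aperiodic L) {a b : ℕ} (hb : b ≤ L.length)
    (hab : L.rotate a = L.rotate b) : L.length ∣ a + (L.length - b) := by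
  apply h
  rw [← List.rotate_rotate, hab, List.rotate_rotate, Nat.add_sub_cancel' hb, List.rotate_length]

theorem rotate_congr {L : List β} {a b : ℕ} (h : a % L.length = b % L.length) :
    L.rotate a = L.rotate b := by
  rw [← List.rotate_mod, h, List.rotate_mod]

theorem reverse_rotate_of_lt {L : List β} {m i : ℕ} (h : L.reverse = L.rotate m)
    (hi : i < L.length) : (L.rotate i).reverse = L.rotate (m + (L.length - i)) := by
  rw [List.reverse_rotate, Nat.mod_eq_of_lt hi, h, List.rotate_rotate]

theorem exists_rotate_eq_of_isRotated {L M : List β} (h : M ~r L) (hL : 0 < L.length) :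
    ∃ k < L.length, M = L.rotate k := by
  obtain ⟨k, rfl⟩ := h.symm
  exact ⟨k % L.length, Nat.mod_lt _ hL, (List.rotate_mod _ _).symm⟩

theorem existsUnique_palindrome_of_odd {L : List β} (hL : Aperiodic L) (hrev : L.reverse ~r L)
    (hodd : Odd L.length) : ∃! M, M ~r L ∧ M.Palindrome := by
  have hpos := hodd.pos
  apply existsUnique_of_exists_of_unique
  · obtain ⟨m, hm, h⟩ := exists_rotate_eq_of_isRotated hrev hpos
    -- The rotation by `i` is a palindrome once `2 * i ≡ m` modulo the odd length.
    obtain ⟨i, hi, him⟩ : ∃ i < L.length, 2 * i = m ∨ 2 * i = m + L.length := by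
      obtain ⟨r, hr⟩ := hodd
      rcases Nat.even_or_odd' m with ⟨s, hs | hs⟩
      · exact ⟨s, by omega, by omega⟩
      · exact ⟨s + r + 1, by omega, by omega⟩
    refine ⟨L.rotate i, List.IsRotated.forall _ _, List.Palindrome.of_reverse_eq ?_⟩
    rw [reverse_rotate_of_lt h hi]
    apply rotate_congr
    rcases him with him | him
    · rw [show m + (L.length - i) = i + L.length by omega, Nat.add_mod_right]
    · congr 1
      omega
  · rintro M M' ⟨hM, hp⟩ ⟨hM', hp'⟩
    have hlen := hM.perm.length_eq
    rw [← hlen] at hodd hpos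
    obtain ⟨k, hk, rfl⟩ := exists_rotate_eq_of_isRotated (hM'.trans hM.symm) hpos
    have h1 := hp'.reverse_eq
    rw [reverse_rotate_of_lt (m := 0) (by rw [hp.reverse_eq, List.rotate_zero]) hk, zero_add] at h1
    have h2 := (hL.of_isRotated hM).dvd_of_rotate_eq (by omega) h1.symm
    rw [show k + (M.length - (M.length - k)) = 2 * k by omega] at h2
    have h3 := (Nat.Coprime.dvd_of_dvd_mul_left
      (Nat.coprime_two_right.2 hodd) h2)
    rw [Nat.eq_zero_of_dvd_of_lt h3 hk, List.rotate_zero]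

theorem exists_halves_of_palindrome {w : List β} (h : w.Palindrome) :
    ∃ q, w = q ++ q.reverse ∨ ∃ z, w = q ++ z :: q.reverse := by
  induction h with
  | nil => exact ⟨[], by simp⟩
  | singleton z => exact ⟨[], by simp⟩
  | cons_concat a _ ih =>
    obtain ⟨q, rfl | ⟨z, rfl⟩⟩ := ih
    · exact ⟨a :: q, by simp⟩
    · exact ⟨a :: q, .inr ⟨z, by simp⟩⟩

theorem not_palindrome_of_odd_countP {w : List β} {p : β → Bool} (hlen : Even w.length)
    (hp : Odd (w.countP p)) : ¬ w.Palindrome := by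
  intro h
  obtain ⟨q, rfl | ⟨z, rfl⟩⟩ := exists_halves_of_palindrome h
  · rw [List.countP_append, List.countP_reverse] at hp
    grind
  · simp at hlen
    grind

/-- In a word that consists of a letter followed by a palindrome and in which the letters with a
given property are odd in number, exactly one of the initial and the central letter has it. -/
theorem exists_center_of_palindrome {z : β} {w : List β} {p : β → Bool} (hw : w.Palindrome)
    (hlen : Odd w.length) (hp : Odd ((z :: w).countP p)) :
    ∃ q z', w = q ++ z' :: q.reverse ∧ (p z' = !p z) := by
  obtain ⟨q, rfl | ⟨z', rfl⟩⟩ := exists_halves_of_palindrome hw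
  · simp at hlen
    grind
  · refine ⟨q, z', rfl, ?_⟩
    simp only [List.countP_cons, List.countP_append, List.countP_reverse] at hp
    cases h1 : p z <;> cases h2 : p z' <;> simp [h1, h2] at hp ⊢ <;> grind

theorem existsUnique_cons_palindrome_of_even {L : List β} {p : β → Bool} (hL : Aperiodic L)
    (hrev : L.reverse ~r L) (heven : Even L.length) (hp : Odd (L.countP p)) :
    ∃! M, M ~r L ∧ ∃ z w, M = z :: w ∧ p z ∧ w.Palindrome := by
  have hpos : 0 < L.length := by
    rcases L.length.eq_zero_or_pos with h0 | hpos
    · rw [List.length_eq_zero_iff] at h0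
      simp [h0] at hp
    · exact hpos
  apply existsUnique_of_exists_of_unique
  · obtain ⟨m, hm, h⟩ := exists_rotate_eq_of_isRotated hrev hpos
    obtain ⟨r, hr | hr⟩ := Nat.even_or_odd' m
    · have hperm := List.rotate_perm L r
      have hnp : ¬ (L.rotate r).Palindrome := not_palindrome_of_odd_countP
        (p := p) (by rwa [List.length_rotate]) (by rwa [hperm.countP_eq])
      refine absurd (List.Palindrome.of_reverse_eq ?_) hnp
      rw [reverse_rotate_of_lt h (by omega)]
      apply rotate_congr
      rw [show m + (L.length - r) = r + L.length by omega, Nat.add_mod_right]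
    -- With `m = 2 * r + 1`, reversing the rotation by `r` shifts it by one, so it is a letter
    -- followed by a palindrome.
    · have h1 : (L.rotate r).reverse = (L.rotate r).rotate 1 := by
        rw [reverse_rotate_of_lt h (by omega), List.rotate_rotate]
        apply rotate_congr
        rw [show m + (L.length - r) = r + 1 + L.length by omega, Nat.add_mod_right]
      have h2 : L.rotate r ~r L := List.IsRotated.forall _ _
      revert h1 h2
      cases L.rotate r with
      | nil =>
        intro _ h2
        have := h2.perm.length_eq
        simp at this
        omega
      | cons z w =>
        intro h1 h2
        have hw : w.Palindrome := List.Palindrome.of_reverse_eq (by simpa using h1)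
        have hlen : Odd w.length := by
          have := h2.perm.length_eq
          simp at this
          grind
        obtain ⟨q, z', hq, hz'⟩ := exists_center_of_palindrome hw hlen
          (by rwa [h2.perm.countP_eq])
        by_cases hz : p z
        · exact ⟨z :: w, h2, z, w, rfl, hz, hw⟩
        -- The half-turn exchanges the initial letter with the central one.
        · refine ⟨z' :: (q.reverse ++ z :: q), ?_, z', _, rfl, by simp [hz', hz],
            List.Palindrome.of_reverse_eq (by simp)⟩
          refine List.IsRotated.trans ?_ h2
          rw [hq]
          have := List.isRotated_append (l := z' :: q.reverse) (l' := z :: q)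
          simpa using this
  · rintro M M' ⟨hM, z, w, rfl, hz, hw⟩ ⟨hM', z₂, w₂, rfl, hz₂, hw₂⟩
    have hlen := hM.perm.length_eq
    obtain ⟨k, hk, hk'⟩ := exists_rotate_eq_of_isRotated (hM'.trans hM.symm) (by simp)
    have h1 : (z :: w).reverse = (z :: w).rotate 1 := by simp [hw.reverse_eq]
    have h2 : (z₂ :: w₂).reverse = (z₂ :: w₂).rotate 1 := by simp [hw₂.reverse_eq]
    rw [hk', reverse_rotate_of_lt h1 hk, List.rotate_rotate] at h2
    rcases k.eq_zero_or_pos with rfl | hkpos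
    · rw [hk', List.rotate_zero]
    have h3 := (hL.of_isRotated hM).dvd_of_rotate_eq (by omega) h2.symm
    -- Only the half-turn remains, and it puts `z'`, which fails `p`, in front.
    rw [show k + 1 + ((z :: w).length - (1 + ((z :: w).length - k))) = 2 * k by omega] at h3
    obtain ⟨d, hd⟩ := h3
    have hd1 : d = 1 := by nlinarith
    rw [hd1, mul_one] at hd
    exfalso
    obtain ⟨q, z', rfl, hz'⟩ := exists_center_of_palindrome hw
      (by simp at hlen; grind) (by rwa [hM.perm.countP_eq])
    have hkq : k = (z :: q).length := by
      simp at hd ⊢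
      omega
    have : z :: (q ++ z' :: q.reverse) = (z :: q) ++ (z' :: q.reverse) := by simp
    rw [this, hkq, List.rotate_append_length_eq] at hk'
    simp at hk'
    rw [hk'.1, hz', hz] at hz₂
    simp at hz₂

end CyclicWords

/-! ### From group elements back to cyclic words. -/

section Assembly

theorem Coherent.expSum_mk {α : Type} [DecidableEq α] {ε : α → Bool} (i : α)
    {L : List (α × Bool)} (hL : Coherent ε L) :
    expSum i (FreeGroup.mk L) = (bif ε i then 1 else -1) * (L.countP (·.1 = i) : ℤ) := by
  induction L with
  | nil => simp [expSum, ← one_eq_mk]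
  | cons s L ih =>
    have hs := hL s (by simp)
    have h1 : expSum i (FreeGroup.mk [s]) = if s.1 = i then bif ε i then 1 else -1 else 0 := by
      obtain ⟨j, b⟩ := s
      simp only at hs
      by_cases hj : j = i
      · subst hj
        cases h : ε j <;> simp [expSum, hs, h, lift_mk]
      · cases b <;> simp [expSum, lift_mk, hj]
    have h2 : FreeGroup.mk (s :: L) = FreeGroup.mk [s] * FreeGroup.mk L := by
      rw [mul_mk]
      rfl
    rw [h2, expSum_mul, h1, ih fun t ht => hL t (by simp [ht]), List.countP_cons]
    by_cases h : s.1 = i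
    · simp [h, mul_add, add_comm]
    · simp [h]

theorem length_eq_countP_add_countP (L : List (Fin 2 × Bool)) :
    L.length = L.countP (·.1 = 0) + L.countP (·.1 = 1) := by
  induction L with
  | nil => simp
  | cons s L ih =>
    obtain ⟨i, b⟩ := s
    rw [List.length_cons, List.countP_cons, List.countP_cons, ih]
    fin_cases i <;> simp <;> omega

theorem Coherent.existsUnique_toWord {α : Type} [DecidableEq α] {ε : α → Bool}
    {L : List (α × Bool)} (hL : Coherent ε L) {P : List (α × Bool) → Prop}
    (h : ∃! M, M ~r L ∧ P M) : ∃! g : FreeGroup α, g.toWord ~r L ∧ P g.toWord := by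
  obtain ⟨M, ⟨hM, hPM⟩, huniq⟩ := h
  have hw := toWord_mk_of_isReduced (hL.of_isRotated hM).isReduced
  refine ⟨FreeGroup.mk M, by simpa only [hw] using ⟨hM, hPM⟩, fun g hg => ?_⟩
  rw [← mk_toWord (x := g), huniq _ hg]

theorem toWord_of_zpow {α : Type} [DecidableEq α] (i : α) (b : Bool) :
    (FreeGroup.of i ^ (bif b then 1 else -1 : ℤ)).toWord = [(i, b)] := by
  cases b <;> simp [FreeGroup.toWord_inv, invRev]

/-- The prescribed length forces `g` to be a rotation of `c`; conversely coherence forces the sign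
of the initial letter. -/
theorem isConj_and_exists_isConcat_iff {α : Type} [DecidableEq α] {ε : α → Bool}
    {p c g : FreeGroup α} (hpc : IsConj p c) (hc : Coherent ε c.toWord) {i : α} {n e' : ℤ}
    (he' : e' = bif ε i then 1 else -1) (hn : n = c.norm) :
    (IsConj p g ∧ ∃ (e : ℤ) (w : FreeGroup α), (e = 1 ∨ e = -1) ∧ e = e' ∧ IsPalindrome w ∧
      (w.norm : ℤ) = n - 1 ∧ IsConcat g (FreeGroup.of i ^ e) w) ↔
    g.toWord ~r c.toWord ∧ ∃ z w, g.toWord = z :: w ∧ (decide (z.1 = i) = true) ∧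
      w.Palindrome := by
  subst hn he'
  constructor
  · rintro ⟨hpg, e, w, -, rfl, hw, hwn, hconcat⟩
    rw [IsConcat, toWord_of_zpow] at hconcat
    refine ⟨hc.isRotated_of_norm_eq (hpc.symm.trans hpg) ?_, _, _, hconcat, by simp, hw⟩
    rw [FreeGroup.norm, hconcat]
    simp only [FreeGroup.norm] at hwn ⊢
    simp
    omega
  · rintro ⟨hrot, ⟨j, b⟩, w, hg, hj, hw⟩
    obtain rfl : j = i := by simpa using hj
    have hpg := hpc.trans (isConj_mk_of_isRotated hrot)
    rw [mk_toWord] at hpg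
    have hcoh := hc.of_isRotated hrot
    have hb : b = ε j := hcoh (j, b) (by simp [hg])
    have hww : (FreeGroup.mk w).toWord = w := toWord_mk_of_isReduced
      (Coherent.isReduced (ε := ε) fun s hs => hcoh s (by simp [hg, hs]))
    refine ⟨hpg, _, FreeGroup.mk w, ?_, rfl, ?_, ?_, ?_⟩
    · cases ε j <;> simp
    · rwa [IsPalindrome, hww]
    · have := hrot.perm.length_eq
      rw [hg] at this
      simp only [FreeGroup.norm, hww, ← this]
      simp
    · rw [IsConcat, toWord_of_zpow, hg, hww, hb]
      rfl

theorem Coherent.isConj_and_isPalindrome_iff {α : Type} [DecidableEq α] {ε : α → Bool}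
    {p c g : FreeGroup α} (hpc : IsConj p c) (hc : Coherent ε c.toWord) :
    IsConj p g ∧ IsPalindrome g ↔ g.toWord ~r c.toWord ∧ g.toWord.Palindrome := by
  constructor
  · rintro ⟨hpg, hg⟩
    exact ⟨hc.isRotated_of_isPalindrome (hpc.symm.trans hpg) hg, hg⟩
  · rintro ⟨hrot, hg⟩
    have := hpc.trans (isConj_mk_of_isRotated hrot)
    rw [mk_toWord] at this
    exact ⟨this, hg⟩

theorem Coherent.expSum_eq {α : Type} [DecidableEq α] {ε : α → Bool} {p c : FreeGroup α}
    (hpc : IsConj p c) (hc : Coherent ε c.toWord) (i : α) :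
    expSum i p = (bif ε i then 1 else -1) * (c.toWord.countP (·.1 = i) : ℤ) := by
  rw [expSum_eq_of_isConj i hpc, ← hc.expSum_mk i, mk_toWord]

end Assembly

end FreeGroupWords

open FreeGroupWords in
theorem theorem1 (p : FreeGroup (Fin 2)) (hp : FreeGroupWords.IsPrimitive p)
    (X Y : ℤ) (hX : X = FreeGroupWords.expSum 0 p) (hY : Y = FreeGroupWords.expSum 1 p) :
    (Odd (X + Y) ↔
      ∃! g : FreeGroup (Fin 2), IsConj p g ∧ FreeGroupWords.IsPalindrome g) ∧
    (Even (X + Y) →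
      (¬ ∃ g : FreeGroup (Fin 2), IsConj p g ∧ FreeGroupWords.IsPalindrome g) ∧
      (∃! g : FreeGroup (Fin 2), IsConj p g ∧
        ∃ (ε : ℤ) (w : FreeGroup (Fin 2)), (ε = 1 ∨ ε = -1) ∧ ε = X.sign ∧
          FreeGroupWords.IsPalindrome w ∧ (w.norm : ℤ) = |X| + |Y| - 1 ∧
          FreeGroupWords.IsConcat g (FreeGroupWords.x ^ ε) w) ∧
      (∃! g : FreeGroup (Fin 2), IsConj p g ∧
        ∃ (δ : ℤ) (v : FreeGroup (Fin 2)), (δ = 1 ∨ δ = -1) ∧ δ = Y.sign ∧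
          FreeGroupWords.IsPalindrome v ∧ (v.norm : ℤ) = |X| + |Y| - 1 ∧
          FreeGroupWords.IsConcat g (FreeGroupWords.y ^ δ) v)) := by
  obtain ⟨c, ε, hpc, hc, hrev⟩ := hp.exists_coherent
  have hcop := hp.isCoprime_expSum
  rw [← hX, ← hY, Int.isCoprime_iff_gcd_eq_one, Int.gcd] at hcop
  have hX' := hX.trans (hc.expSum_eq hpc 0)
  have hY' := hY.trans (hc.expSum_eq hpc 1)
  set k := c.toWord.countP (·.1 = 0) with hk
  set l := c.toWord.countP (·.1 = 1) with hl
  have hlen : c.toWord.length = k + l := length_eq_countP_add_countP _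
  have hXk : X.natAbs = k := by cases h : ε 0 <;> simp [hX', h]
  have hYl : Y.natAbs = l := by cases h : ε 1 <;> simp [hY', h]
  rw [hXk, hYl] at hcop
  have haper : Aperiodic c.toWord := aperiodic_of_coprime_countP hcop
  have hnorm : |X| + |Y| = c.norm := by
    rw [Int.abs_eq_natAbs, Int.abs_eq_natAbs, hXk, hYl, FreeGroup.norm, hlen]
    push_cast
    rfl
  have heven_iff : Even (X + Y) ↔ Even (k + l) := by
    rw [Int.even_add, Nat.even_add, ← hXk, ← hYl, Int.natAbs_even, Int.natAbs_even]
  simp only [hc.isConj_and_isPalindrome_iff hpc]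
  -- Coprime counts with even sum are both odd, whereas a palindrome of even length has even counts.
  have hnone : Even (X + Y) → Odd k ∧ Odd l ∧
      ¬ ∃ g : FreeGroup (Fin 2), g.toWord ~r c.toWord ∧ g.toWord.Palindrome := by
    intro h
    rw [heven_iff, Nat.even_add] at h
    have hk2 : Odd k := by
      rw [← Nat.not_even_iff_odd]
      intro hke
      exact Nat.not_coprime_of_dvd_of_dvd one_lt_two hke.two_dvd (h.1 hke).two_dvd hcop
    have hl2 : Odd l := by
      rw [← Nat.not_even_iff_odd] at hk2 ⊢
      exact fun hle => hk2 (h.2 hle)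
    refine ⟨hk2, hl2, ?_⟩
    rintro ⟨g, hrot, hg⟩
    refine not_palindrome_of_odd_countP (p := (·.1 = 0)) ?_ ?_ hg
    · rw [hrot.perm.length_eq, hlen]
      exact hk2.add_odd hl2
    · rwa [hrot.perm.countP_eq]
  refine ⟨⟨fun h => ?_, fun h => ?_⟩, fun h => ?_⟩
  · refine hc.existsUnique_toWord (existsUnique_palindrome_of_odd haper hrev ?_)
    rwa [hlen, ← Nat.not_even_iff_odd, ← heven_iff, Int.not_even_iff_odd]
  · rw [← Int.not_even_iff_odd]
    exact fun he => (hnone he).2.2 h.exists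
  · obtain ⟨hk2, hl2, hno⟩ := hnone h
    have hlen2 : Even c.toWord.length := hlen ▸ hk2.add_odd hl2
    refine ⟨hno, ?_, ?_⟩
    · have hsign : X.sign = bif ε 0 then 1 else -1 := by
        have := hk2.pos
        cases h : ε 0 <;> simp [hX', h, this]
      simp only [x, isConj_and_exists_isConcat_iff hpc hc hsign hnorm]
      exact hc.existsUnique_toWord (existsUnique_cons_palindrome_of_even haper hrev hlen2 hk2)
    · have hsign : Y.sign = bif ε 1 then 1 else -1 := by
        have := hl2.pos
        cases h : ε 1 <;> simp [hY', h, this]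
      simp only [y, isConj_and_exists_isConcat_iff hpc hc hsign hnorm]
      exact hc.existsUnique_toWord (existsUnique_cons_palindrome_of_even haper hrev hlen2 hl2)
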